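/- A \emph{category of interest} is a variety of universal algebras (with all homomorphisms) presented by a set $\Omega$ of finitary operations and a set $\mathbb{E}$ of identities such that, writing $\Omega_i$ for the set of $i$-ary operations: (CI1) $\Omega=\Omega_0\cup\Omega_1\cup\Omega_2$; (CI2) $\Omega_0=\{0\}$, $-\in\Omega_1$, $+\in\Omega_2$, and $\mathbb{E}$ includes the group laws for $0,-,+$; put $\Omega_1'=\Omega_1\setminus\{-\}$, $\Omega_2'=\Omega_2\setminus\{+\}$; (CI3) for each $*\in\Omega_2'$ there is $\bullet\in\Omega_2'$ with $x\bullet y=y*x$; (CI4) $\omega(x+y)=\omega(x)+\omega(y)$ for all $\omega\in\Omega_1'$; (CI5) $x*(y+z)=x*y+x*z$ for all $*\in\Omega_2'$; (CI6) $\omega(x)*y=\omega(x*y)$ for all $\omega\in\Omega_1'$, $*\in\Omega_2'$; (CI7) $x+(y*z)=(y*z)+x$ for all $*\in\Omega_2'$; (CI8) for all $*,\bullet\in\Omega_2'$ there are $0\le m\le n$, operations $*_1,\dots,*_n,\bullet_1,\dots,\bullet_n\in\Omega_2'$ and a word $w$ such that $$(x*y)\bullet z=w\big(x*_1(y\bullet_1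 z),\dots,x*_m(y\bullet_m z),\,y*_{m+1}(x\bullet_{m+1}z),\dots,y*_n(x\bullet_n z)\big).$$ (In (CI3)--(CI8) the displayed identities are required to be among the identities of the variety, that is, consequences of $\mathbb{E}$.) In a semi-abelian category, a subobject is \emph{normal} if it is a kernel. For subobjects $k\colon K\to X$ and $l\colon L\to X$, the \emph{Higgins commutator} $[K,L]\le X$ is the regular image of the composite $K\diamond L\to K+L\to X$, where $K\diamond L\to K+L$ is the kernel of the canonical morphism $\left(\begin{smallmatrix}1_K&0\\0&1_L\end{smallmatrix}\right)\colon K+L\to K\times L$ and $K+L\to X$ is the morphism induced by $k$ and $l$. A semi-abelian category satisfies \emph{(NH)} if $[K,L]$ is normal in $X$ for every object $X$ and every pair of normal subobjects $K,L$ of $X$. \textbf{Theorem.} Let $\mathcal{C}$ be a category of interest (such a category is semi-abelian). If $X$ is an object of $\mathcal{C}$ and $K$, $L$ are normal subobjects of $X$, then the Higgins commutator $[K,L]$ is normal in $X$. In other words, $\mathcal{C}$ satisfies (NH). -/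

import Mathlib

open CategoryTheory CategoryTheory.Limits FirstOrder FirstOrder.Language

universe v u

/-! ### Semi-abelian categories, Higgins commutators and the condition (NH) -/

namespace SemiAb

section
variable {C : Type u} [Category.{v} C]

/-- A pair `r₁ r₂ : R ⟶ X` is an internal equivalence relation on `X`. -/
structure IsEquivalenceRelation {R X : C} (r₁ r₂ : R ⟶ X) : Prop where
  jointly_mono : ∀ {T : C} (a b : T ⟶ R), a ≫ r₁ = b ≫ r₁ → a ≫ r₂ = b ≫ r₂ → a = b
  refl : ∃ d : X ⟶ R, d ≫ r₁ = 𝟙 X ∧ d ≫ r₂ = 𝟙 X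
  symm : ∃ t : R ⟶ R, t ≫ r₁ = r₂ ∧ t ≫ r₂ = r₁
  trans : ∀ {T : C} (a b : T ⟶ R), a ≫ r₂ = b ≫ r₁ →
    ∃ c : T ⟶ R, c ≫ r₁ = a ≫ r₁ ∧ c ≫ r₂ = b ≫ r₂

end

/-- A semi-abelian category: a pointed category with binary coproducts which is Barr exact
(regular, and every internal equivalence relation is a kernel pair) and Bourn protomodular
(stated, as one may in the pointed case, as the Split Short Five Lemma). -/
class SemiAbelian (C : Type u) [Category.{v} C] [HasZeroMorphisms C] : Prop
    extends Regular C, HasZeroObject C where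
  hasBinaryCoproducts : HasBinaryCoproducts C
  exact : ∀ {R X : C} (r₁ r₂ : R ⟶ X), IsEquivalenceRelation r₁ r₂ →
    ∃ (Q : C) (q : X ⟶ Q), IsKernelPair q r₁ r₂
  protomodular : ∀ {K A B K' A' B' : C} (k : K ⟶ A) (p : A ⟶ B) (s : B ⟶ A)
    (k' : K' ⟶ A') (p' : A' ⟶ B') (s' : B' ⟶ A') (hk : k ≫ p = 0) (hk' : k' ≫ p' = 0)
    (f : K ⟶ K') (g : A ⟶ A') (h : B ⟶ B'),
    Nonempty (IsLimit (KernelFork.ofι k hk)) → Nonempty (IsLimit (KernelFork.ofι k' hk')) →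
    s ≫ p = 𝟙 B → s' ≫ p' = 𝟙 B' →
    k ≫ g = f ≫ k' → p ≫ h = g ≫ p' → s ≫ g = h ≫ s' →
    IsIso f → IsIso h → IsIso g

attribute [instance] SemiAbelian.hasBinaryCoproducts

section
variable {C : Type u} [Category.{v} C] [HasZeroMorphisms C]

/-- A subobject is normal when it is represented by a kernel. -/
def IsNormal {X : C} (K : Subobject X) : Prop := Nonempty (NormalMono K.arrow)

variable [SemiAbelian C]

/-- The canonical morphism `K ⨿ L ⟶ K ⨯ L` with matrix `(1 0; 0 1)`. -/
noncomputable def coprodToProd (K L : C) : K ⨿ L ⟶ K ⨯ L :=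
  coprod.desc (prod.lift (𝟙 K) 0) (prod.lift 0 (𝟙 L))

/-- The co-smash product `K ⋄ L`. -/
noncomputable def coSmash (K L : C) : C := kernel (coprodToProd K L)

/-- The inclusion `κ : K ⋄ L ⟶ K ⨿ L`. -/
noncomputable def coSmashι (K L : C) : coSmash K L ⟶ K ⨿ L := kernel.ι (coprodToProd K L)

/-- The Higgins commutator `[K, L] ≤ X`: the (regular) image of
`K ⋄ L ⟶ K ⨿ L ⟶ X`. -/
noncomputable def higginsCommutator {X : C} (K L : Subobject X) : Subobject X :=
  imageSubobject (coSmashι (K : C) (L : C) ≫ coprod.desc K.arrow L.arrow)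

variable (C) in
/-- Normality of Higgins commutators: the condition (NH). -/
def NH : Prop := ∀ (X : C) (K L : Subobject X), IsNormal K → IsNormal L →
  IsNormal (higginsCommutator K L)

end

end SemiAb

/-! ### Varieties of universal algebras -/

/-- A presentation of a variety: a signature of finitary operations (a first-order language
without relation symbols) and a set of identities in countably many variables. -/
structure EquationalTheory where
  lang : FirstOrder.Language.{u, 0}
  [algebraic : lang.IsAlgebraic]
  identities : Set (lang.Term ℕ × lang.Term ℕ)

namespace EquationalTheory

attribute [instance] EquationalTheory.algebraic

variable (T : EquationalTheory.{u})

/-- The algebras of the variety. -/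
structure Alg where
  carrier : Type u
  [str : T.lang.Structure carrier]
  sat : ∀ e ∈ T.identities, ∀ x : ℕ → carrier, e.1.realize x = e.2.realize x

variable {T}

namespace Alg

attribute [instance] Alg.str

instance : CoeSort T.Alg (Type u) := ⟨Alg.carrier⟩

/-- Morphisms of algebras: the maps preserving all operations. -/
@[ext]
structure Hom (A B : T.Alg) where
  hom : A →[T.lang] B

instance : Category T.Alg where
  Hom A B := Hom A B
  id A := ⟨FirstOrder.Language.Hom.id T.lang A⟩
  comp f g := ⟨g.hom.comp f.hom⟩

/-- The value of a constant symbol. -/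
def op₀ {A : T.Alg} (c : T.lang.Functions 0) : A := Structure.funMap c ![]

/-- The value of a unary operation. -/
def op₁ {A : T.Alg} (f : T.lang.Functions 1) (x : A) : A := Structure.funMap f ![x]

/-- The value of a binary operation. -/
def op₂ {A : T.Alg} (f : T.lang.Functions 2) (x y : A) : A := Structure.funMap f ![x, y]

/-- The value of a word. -/
def eval (A : T.Alg) {α : Type*} (w : T.lang.Term α) (x : α → A) : A := w.realize x

end Alg

end EquationalTheory

open EquationalTheory EquationalTheory.Alg

/-- A category of interest, given by its presentation. That the set of identities "includes" an
identity means that the identity is a consequence of it, i.e. holds in every algebra of the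
variety. The set `Ω₁'` is `{ω : lang.Functions 1 | ω ≠ neg}` and `Ω₂'` is
`{m : lang.Functions 2 | m ≠ add}`. -/
structure CategoryOfInterest extends EquationalTheory.{u} where
  /-- There are only operations of arity at most two. -/
  arity_le_two : ∀ n, lang.Functions n → n ≤ 2
  /-- There is exactly one constant, and the group laws hold. -/
  zero : lang.Functions 0
  zero_unique : ∀ c : lang.Functions 0, c = zero
  neg : lang.Functions 1
  add : lang.Functions 2
  add_assoc : ∀ (A : toEquationalTheory.Alg) (x y z : A),
    op₂ add (op₂ add x y) z = op₂ add x (op₂ add y z)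
  zero_add : ∀ (A : toEquationalTheory.Alg) (x : A), op₂ add (op₀ zero) x = x
  add_zero : ∀ (A : toEquationalTheory.Alg) (x : A), op₂ add x (op₀ zero) = x
  neg_add : ∀ (A : toEquationalTheory.Alg) (x : A), op₂ add (op₁ neg x) x = op₀ zero
  add_neg : ∀ (A : toEquationalTheory.Alg) (x : A), op₂ add x (op₁ neg x) = op₀ zero
  /-- Every operation in `Ω₂'` has its opposite in `Ω₂'`. -/
  exists_opposite : ∀ m : lang.Functions 2, m ≠ add → ∃ m' : lang.Functions 2, m' ≠ add ∧
    ∀ (A : toEquationalTheory.Alg) (x y : A), op₂ m' x y = op₂ m y x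
  /-- Every operation in `Ω₁'` is additive. -/
  map_add : ∀ ω : lang.Functions 1, ω ≠ neg → ∀ (A : toEquationalTheory.Alg) (x y : A),
    op₁ ω (op₂ add x y) = op₂ add (op₁ ω x) (op₁ ω y)
  /-- Every operation in `Ω₂'` distributes over addition. -/
  mul_add : ∀ m : lang.Functions 2, m ≠ add → ∀ (A : toEquationalTheory.Alg) (x y z : A),
    op₂ m x (op₂ add y z) = op₂ add (op₂ m x y) (op₂ m x z)
  /-- Operations in `Ω₁'` are compatible with those in `Ω₂'`. -/
  map_mul : ∀ ω : lang.Functions 1, ω ≠ neg → ∀ m : lang.Functions 2, m ≠ add →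
    ∀ (A : toEquationalTheory.Alg) (x y : A), op₂ m (op₁ ω x) y = op₁ ω (op₂ m x y)
  /-- Products are central for the addition. -/
  add_mul_comm : ∀ m : lang.Functions 2, m ≠ add → ∀ (A : toEquationalTheory.Alg) (x y z : A),
    op₂ add x (op₂ m y z) = op₂ add (op₂ m y z) x
  /-- `(x * y) • z` is a word `w` in elements `x *ᵢ (y •ᵢ z)` and `y *ⱼ (x •ⱼ z)`. -/
  mul_mul : ∀ m : lang.Functions 2, m ≠ add → ∀ d : lang.Functions 2, d ≠ add →
    ∃ (a b : ℕ) (w : lang.Term (Fin a ⊕ Fin b)) (ms ds : Fin a ⊕ Fin b → lang.Functions 2),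
      (∀ i, ms i ≠ add) ∧ (∀ i, ds i ≠ add) ∧
      ∀ (A : toEquationalTheory.Alg) (x y z : A),
        op₂ d (op₂ m x y) z = A.eval w (Sum.elim
          (fun i => op₂ (ms (Sum.inl i)) x (op₂ (ds (Sum.inl i)) y z))
          (fun j => op₂ (ms (Sum.inr j)) y (op₂ (ds (Sum.inr j)) x z)))

namespace CategoryOfInterest

/-- The category of algebras of the variety. -/
abbrev Algebras (𝒱 : CategoryOfInterest.{u}) := 𝒱.toEquationalTheory.Alg

end CategoryOfInterest

/-! ### Elementary constructions in a variety -/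

namespace EquationalTheory

variable {T : EquationalTheory.{u}}

namespace Alg

theorem hom_ext {A B : T.Alg} {f g : A ⟶ B} (h : ∀ x, f.hom x = g.hom x) : f = g :=
  Hom.ext (FirstOrder.Language.Hom.ext h)

@[simp] theorem id_hom_apply {A : T.Alg} (x : A) : Hom.hom (𝟙 A) x = x := rfl

@[simp] theorem comp_hom_apply {A B D : T.Alg} (f : A ⟶ B) (g : B ⟶ D) (x : A) :
    (f ≫ g).hom x = g.hom (f.hom x) := rfl

theorem congr_hom {A B : T.Alg} {f g : A ⟶ B} (h : f = g) (x : A) : f.hom x = g.hom x := by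
  rw [h]

/-- A map preserving operations is a morphism. -/
def mkHom {A B : T.Alg} (f : A → B)
    (hf : ∀ {n} (s : T.lang.Functions n) (x : Fin n → A),
      f (Structure.funMap s x) = Structure.funMap s (f ∘ x)) : A ⟶ B :=
  ⟨{ toFun := f, map_fun' := hf, map_rel' := fun r => isEmptyElim r }⟩

@[simp] theorem mkHom_hom_apply {A B : T.Alg} (f : A → B) (hf) (x : A) :
    (mkHom f hf : A ⟶ B).hom x = f x := rfl

theorem isIso_of_bijective {A B : T.Alg} (f : A ⟶ B) (hf : Function.Bijective f.hom) :
    IsIso f := by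
  let e := Equiv.ofBijective _ hf
  have he : ∀ x, f.hom (e.symm x) = x := fun x => e.apply_symm_apply x
  refine ⟨⟨mkHom e.symm ?_, ?_, ?_⟩⟩
  · intro n s x
    apply hf.1
    rw [he, FirstOrder.Language.Hom.map_fun]
    congr 1
    funext i
    exact (he _).symm
  · exact hom_ext fun x => e.symm_apply_apply x
  · exact hom_ext fun x => he x

theorem bijective_of_isIso {A B : T.Alg} (f : A ⟶ B) [IsIso f] : Function.Bijective f.hom :=
  Function.bijective_iff_has_inverse.2 ⟨(inv f).hom,
    fun x => congr_hom (IsIso.hom_inv_id f) x, fun x => congr_hom (IsIso.inv_hom_id f) x⟩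

/-- A structure with jointly injective homomorphisms into algebras is an algebra. -/
def ofInjective {M : Type u} [T.lang.Structure M] {ι : Type*} (B : ι → T.Alg)
    (p : ∀ i, M →[T.lang] B i) (hp : ∀ x y, (∀ i, p i x = p i y) → x = y) : T.Alg where
  carrier := M
  sat e he x := hp _ _ fun i => by
    rw [← HomClass.realize_term, ← HomClass.realize_term]
    exact (B i).sat e he _

/-- The subalgebra given by a set closed under the operations. -/
def sub {A : T.Alg} (S : T.lang.Substructure A) : T.Alg :=
  ofInjective (M := S) (fun _ : Unit => A) (fun _ => S.subtype.toHom)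
    fun _ _ h => S.subtype_injective (h ())

/-- The inclusion of a subalgebra. -/
def subι {A : T.Alg} (S : T.lang.Substructure A) : sub S ⟶ A := ⟨S.subtype.toHom⟩

theorem subι_injective {A : T.Alg} (S : T.lang.Substructure A) :
    Function.Injective (subι S).hom := S.subtype_injective

instance prodStructure (A B : T.Alg) : T.lang.Structure (A.carrier × B.carrier) where
  funMap s x := (Structure.funMap s fun i => (x i).1, Structure.funMap s fun i => (x i).2)
  RelMap r := isEmptyElim r

/-- The product of two algebras. -/
def prodAlg (A B : T.Alg) : T.Alg :=
  ofInjective (M := A.carrier × B.carrier) (ι := Bool) (fun b => bif b then A else B)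
    (fun b => match b with
      | true => { toFun := Prod.fst, map_fun' := fun _ _ => rfl,
                  map_rel' := fun r => isEmptyElim r }
      | false => { toFun := Prod.snd, map_fun' := fun _ _ => rfl,
                   map_rel' := fun r => isEmptyElim r })
    fun _ _ h => Prod.ext (h true) (h false)

/-- First projection. -/
def pr₁ (A B : T.Alg) : prodAlg A B ⟶ A := mkHom Prod.fst fun _ _ => rfl

/-- Second projection. -/
def pr₂ (A B : T.Alg) : prodAlg A B ⟶ B := mkHom Prod.snd fun _ _ => rfl

/-- The equalizer of two morphisms as a set closed under the operations. -/
def eqSub {A B : T.Alg} (f g : A ⟶ B) : T.lang.Substructure A where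
  carrier := {x | f.hom x = g.hom x}
  fun_mem s x hx := by
    simp only [Set.mem_ofPred_eq, FirstOrder.Language.Hom.map_fun] at hx ⊢
    exact congrArg _ (funext hx)

theorem eqSub_condition {A B : T.Alg} (f g : A ⟶ B) :
    subι (eqSub f g) ≫ f = subι (eqSub f g) ≫ g := hom_ext fun x => x.2

/-- Points of a pullback. -/
theorem exists_of_isPullback {P A B D : T.Alg} {a : P ⟶ A} {b : P ⟶ B} {f : A ⟶ D} {g : B ⟶ D}
    (h : IsPullback a b f g) (x : A) (y : B) (hxy : f.hom x = g.hom y) :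
    ∃ z, a.hom z = x ∧ b.hom z = y := by
  let i := subι (eqSub (pr₁ A B ≫ f) (pr₂ A B ≫ g))
  have hw : (i ≫ pr₁ A B) ≫ f = (i ≫ pr₂ A B) ≫ g := by
    simpa using eqSub_condition (pr₁ A B ≫ f) (pr₂ A B ≫ g)
  refine ⟨(h.lift _ _ hw).hom ⟨(x, y), hxy⟩, ?_, ?_⟩
  · exact congr_hom (h.lift_fst _ _ hw) _
  · exact congr_hom (h.lift_snd _ _ hw) _

/-- Jointly monic pairs are jointly injective. -/
theorem jointly_injective {R A B : T.Alg} {r : R ⟶ A} {s : R ⟶ B}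
    (h : ∀ {Q : T.Alg} (a b : Q ⟶ R), a ≫ r = b ≫ r → a ≫ s = b ≫ s → a = b)
    (x y : R) (h₁ : r.hom x = r.hom y) (h₂ : s.hom x = s.hom y) : x = y := by
  let i := subι (eqSub (pr₁ R R ≫ r) (pr₂ R R ≫ r) ⊓ eqSub (pr₁ R R ≫ s) (pr₂ R R ≫ s))
  have := h (i ≫ pr₁ R R) (i ≫ pr₂ R R) (hom_ext fun z => z.2.1) (hom_ext fun z => z.2.2)
  exact congr_hom this ⟨(x, y), h₁, h₂⟩

theorem injective_of_mono {A B : T.Alg} (f : A ⟶ B) [Mono f] : Function.Injective f.hom :=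
  fun x y h => jointly_injective (r := f) (s := f) (fun _ _ e _ => (cancel_mono f).1 e) x y h h

theorem mono_of_injective {A B : T.Alg} (f : A ⟶ B) (hf : Function.Injective f.hom) : Mono f :=
  ⟨fun _ _ e => hom_ext fun x => hf (congr_hom e x)⟩

/-- The factorization of a morphism through its range. -/
def toRange {A B : T.Alg} (f : A ⟶ B) : A ⟶ sub f.hom.range :=
  ⟨f.hom.codRestrict _ fun x => f.hom.mem_range_self x⟩

theorem toRange_comp {A B : T.Alg} (f : A ⟶ B) : toRange f ≫ subι f.hom.range = f := rfl

theorem toRange_surjective {A B : T.Alg} (f : A ⟶ B) : Function.Surjective (toRange f).hom := by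
  rintro ⟨y, x, rfl⟩
  exact ⟨x, rfl⟩

/-- Factoring a morphism through a surjective one. -/
theorem exists_factor {A B D : T.Alg} (f : A ⟶ B) (hf : Function.Surjective f.hom) (g : A ⟶ D)
    (h : ∀ x y, f.hom x = f.hom y → g.hom x = g.hom y) : ∃ l : B ⟶ D, f ≫ l = g := by
  choose s hs using hf
  have hl : ∀ x, g.hom (s (f.hom x)) = g.hom x := fun x => h _ _ (hs _)
  refine ⟨mkHom (fun y => g.hom (s y)) ?_, hom_ext hl⟩
  intro n o x
  have : x = f.hom ∘ (s ∘ x) := funext fun i => (hs _).symm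
  conv_lhs => rw [this, ← FirstOrder.Language.Hom.map_fun, hl, FirstOrder.Language.Hom.map_fun]
  rfl

theorem epi_of_surjective {A B : T.Alg} (f : A ⟶ B) (hf : Function.Surjective f.hom) : Epi f :=
  ⟨fun g h e => hom_ext fun y => by
    obtain ⟨x, rfl⟩ := hf y
    exact congr_hom e x⟩

/-- A surjective morphism is the coequalizer of any pair which covers its kernel relation. -/
theorem nonempty_isColimit {R A B : T.Alg} (r₁ r₂ : R ⟶ A) (f : A ⟶ B) (w : r₁ ≫ f = r₂ ≫ f)
    (hf : Function.Surjective f.hom)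
    (h : ∀ x y, f.hom x = f.hom y → ∃ z, r₁.hom z = x ∧ r₂.hom z = y) :
    Nonempty (IsColimit (Cofork.ofπ f w)) := by
  have := epi_of_surjective f hf
  refine ⟨Cofork.IsColimit.mk' _ fun s => ?_⟩
  have hl : ∃ l : B ⟶ s.pt, f ≫ l = s.π := exists_factor f hf _ fun x y hxy => by
    obtain ⟨z, rfl, rfl⟩ := h x y hxy
    exact congr_hom s.condition z
  refine ⟨hl.choose, hl.choose_spec, fun {m} hm => ?_⟩
  have hm' : f ≫ m = s.π := hm
  exact (cancel_epi f).1 (hm'.trans hl.choose_spec.symm)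

theorem isRegularEpi_iff {A B : T.Alg} (f : A ⟶ B) :
    IsRegularEpi f ↔ Function.Surjective f.hom := by
  constructor
  · intro h
    let r := h.getStruct
    have hm := mono_of_injective _ (subι_injective f.hom.range)
    have w : r.left ≫ toRange f = r.right ≫ toRange f := by
      rw [← cancel_mono (subι f.hom.range)]
      exact r.w
    let l : B ⟶ sub f.hom.range := r.isColimit.desc (Cofork.ofπ (toRange f) w)
    have hl : f ≫ l = toRange f := r.isColimit.fac (Cofork.ofπ (toRange f) w) .one
    have hl' : l ≫ subι f.hom.range = 𝟙 B :=
      Cofork.IsColimit.hom_ext r.isColimit (by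
        change f ≫ l ≫ _ = f ≫ 𝟙 B
        rw [← Category.assoc, hl, toRange_comp, Category.comp_id])
    intro y
    obtain ⟨x, hx⟩ := (l.hom y).2
    exact ⟨x, hx.trans (congr_hom hl' y)⟩
  · intro h
    let i := subι (eqSub (pr₁ A A ≫ f) (pr₂ A A ≫ f))
    have w : (i ≫ pr₁ A A) ≫ f = (i ≫ pr₂ A A) ≫ f := eqSub_condition _ _
    obtain ⟨hc⟩ := nonempty_isColimit _ _ f w h fun x y hxy => ⟨⟨(x, y), hxy⟩, rfl, rfl⟩
    exact ⟨⟨⟨_, _, _, w, hc⟩⟩⟩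

section limits

variable {J : Type u} [Category.{u} J] (F : J ⥤ T.Alg)

/-- Compatible families. -/
abbrev Sections := {x : ∀ j, (F.obj j).carrier // ∀ {i j} (f : i ⟶ j), (F.map f).hom (x i) = x j}

instance : T.lang.Structure (Sections F) where
  funMap s x := ⟨fun j => Structure.funMap s fun i => (x i).1 j, fun f => by
    rw [FirstOrder.Language.Hom.map_fun]
    exact congrArg _ (funext fun i => (x i).2 f)⟩
  RelMap r := isEmptyElim r

/-- The limit of a diagram of algebras. -/
def limitAlg : T.Alg :=
  ofInjective (M := Sections F) F.obj
    (fun j => { toFun := fun x => x.1 j, map_fun' := fun _ _ => rfl,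
                map_rel' := fun r => isEmptyElim r })
    fun _ _ h => Subtype.ext (funext h)

/-- The limit cone of a diagram of algebras. -/
def limitCone : Cone F where
  pt := limitAlg F
  π := { app := fun j => mkHom (fun x => x.1 j) fun _ _ => rfl
         naturality := fun _ _ f => hom_ext fun x => (x.2 f).symm }

/-- The limit cone is a limit. -/
def limitConeIsLimit : IsLimit (limitCone F) where
  lift s := mkHom (B := limitAlg F)
    (fun x => ⟨fun j => (s.π.app j).hom x, fun f => congr_hom (s.w f) x⟩)
    fun o x => Subtype.ext (funext fun j => (s.π.app j).hom.map_fun o x)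
  fac _ _ := rfl
  uniq _ _ hm := hom_ext fun x => Subtype.ext (funext fun j => congr_hom (hm j) x)

end limits

instance : HasLimits T.Alg := ⟨fun _ _ => ⟨fun F => ⟨⟨⟨limitCone F, limitConeIsLimit F⟩⟩⟩⟩⟩

instance : Regular T.Alg where
  hasCoequalizer_of_isKernelPair {X Y Z f g₁ g₂} h := by
    have w : g₁ ≫ toRange f = g₂ ≫ toRange f :=
      hom_ext fun z => Subtype.ext (congr_hom h.w z)
    obtain ⟨hc⟩ := nonempty_isColimit g₁ g₂ (toRange f) w (toRange_surjective f)
      fun x y hxy => exists_of_isPullback h x y (congrArg Subtype.val hxy)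
    exact ⟨⟨⟨_, hc⟩⟩⟩
  regularEpiIsStableUnderBaseChange := ⟨by
    intro X Y Y' S f g f' g' sq hg
    rw [MorphismProperty.regularEpi_iff, isRegularEpi_iff] at hg ⊢
    intro y
    obtain ⟨x, hx⟩ := hg (f.hom y)
    obtain ⟨z, -, hz⟩ := exists_of_isPullback sq x y hx
    exact ⟨z, hz⟩⟩

section coproducts

variable (K L : T.Alg)

instance termStructure (α : Type u) : T.lang.Structure (T.lang.Term α) where
  funMap s x := Term.func s x
  RelMap r := isEmptyElim r

/-- Two words in the elements of `K` and `L` are identified when they agree in every algebra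
receiving morphisms from `K` and `L`. -/
def coprodSetoid : Setoid (T.lang.Term (K.carrier ⊕ L.carrier)) where
  r s t := ∀ (A : T.Alg) (f : K ⟶ A) (g : L ⟶ A),
    s.realize (Sum.elim f.hom g.hom) = t.realize (Sum.elim f.hom g.hom)
  iseqv := ⟨fun _ _ _ _ => rfl, fun h A f g => (h A f g).symm,
    fun h h' A f g => (h A f g).trans (h' A f g)⟩

instance : T.lang.Prestructure (coprodSetoid K L) where
  toStructure := termStructure _
  fun_equiv _ _ h := fun A f g => congrArg (Structure.funMap _) (funext fun i => h i A f g)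
  rel_equiv {_ r} := isEmptyElim r

/-- Evaluation of words. -/
def coprodDesc {K L A : T.Alg} (f : K ⟶ A) (g : L ⟶ A) :
    Quotient (coprodSetoid K L) →[T.lang] A where
  toFun := Quotient.lift (fun t => t.realize (Sum.elim f.hom g.hom)) fun _ _ h => h A f g
  map_fun' s x := by
    obtain ⟨y, rfl⟩ : ∃ y : Fin _ → T.lang.Term (K.carrier ⊕ L.carrier),
        x = fun i => (⟦y i⟧ : Quotient (coprodSetoid K L)) :=
      ⟨fun i => (x i).out, funext fun i => (Quotient.out_eq _).symm⟩
    rw [funMap_quotient_mk']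
    rfl
  map_rel' r := isEmptyElim r

/-- The coproduct of two algebras. -/
def coprodAlg : T.Alg :=
  ofInjective (M := Quotient (coprodSetoid K L))
    (ι := Σ A : T.Alg, (K ⟶ A) × (L ⟶ A)) (fun i => i.1) (fun i => coprodDesc i.2.1 i.2.2)
    fun x y h => by
      induction x, y using Quotient.inductionOn₂ with
      | h s t => exact Quotient.sound fun A f g => h ⟨A, f, g⟩

/-- First coproduct inclusion. -/
def coprodInl : K ⟶ coprodAlg K L :=
  mkHom (B := coprodAlg K L)
    (fun k => (⟦Term.var (Sum.inl k)⟧ : Quotient (coprodSetoid K L))) fun s x => by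
      refine Eq.trans (Quotient.sound ?_)
        (funMap_quotient_mk' (s := coprodSetoid K L) s fun i => Term.var (Sum.inl (x i))).symm
      intro A f g
      exact f.hom.map_fun s x

/-- Second coproduct inclusion. -/
def coprodInr : L ⟶ coprodAlg K L :=
  mkHom (B := coprodAlg K L)
    (fun k => (⟦Term.var (Sum.inr k)⟧ : Quotient (coprodSetoid K L))) fun s x => by
      refine Eq.trans (Quotient.sound ?_)
        (funMap_quotient_mk' (s := coprodSetoid K L) s fun i => Term.var (Sum.inr (x i))).symm
      intro A f g
      exact g.hom.map_fun s x

theorem coprod_hom_ext {A : T.Alg} {f g : coprodAlg K L ⟶ A}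
    (h₁ : coprodInl K L ≫ f = coprodInl K L ≫ g) (h₂ : coprodInr K L ≫ f = coprodInr K L ≫ g) :
    f = g := by
  refine hom_ext fun x => ?_
  induction x using Quotient.inductionOn with
  | h t =>
    induction t with
    | var a =>
      cases a with
      | inl k => exact congr_hom h₁ k
      | inr l => exact congr_hom h₂ l
    | func s ts ih =>
      have e := funMap_quotient_mk' (s := coprodSetoid K L) s ts
      change f.hom (⟦Term.func s ts⟧ : Quotient (coprodSetoid K L)) =
        g.hom (⟦Term.func s ts⟧ : Quotient (coprodSetoid K L))
      have hs : (⟦Term.func s ts⟧ : Quotient (coprodSetoid K L)) =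
        Structure.funMap s fun i => (⟦ts i⟧ : Quotient (coprodSetoid K L)) := e.symm
      rw [hs]
      refine (f.hom.map_fun s _).trans (Eq.trans ?_ (g.hom.map_fun s _).symm)
      exact congrArg _ (funext ih)

instance : HasBinaryCoproducts T.Alg := by
  have : ∀ {K L : T.Alg}, HasColimit (pair K L) := fun {K L} =>
    ⟨⟨⟨BinaryCofan.mk (coprodInl K L) (coprodInr K L),
      BinaryCofan.IsColimit.mk _ (fun f g => ⟨coprodDesc f g⟩) (fun _ _ => rfl) (fun _ _ => rfl)
        fun f g m h₁ h₂ => coprod_hom_ext K L h₁ h₂⟩⟩⟩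
  exact hasBinaryCoproducts_of_hasColimit_pair _

end coproducts

section quotients

/-- The quotient by a congruence. -/
theorem exists_quotient {A : T.Alg} (r : Setoid A)
    (hr : ∀ {n} (s : T.lang.Functions n) (x y : Fin n → A), (∀ i, r (x i) (y i)) →
      r (Structure.funMap s x) (Structure.funMap s y)) :
    ∃ (Q : T.Alg) (q : A ⟶ Q), ∀ x y, q.hom x = q.hom y ↔ r x y := by
  let _ : T.lang.Prestructure r :=
    { toStructure := A.str, fun_equiv := fun x y h => hr _ x y h,
      rel_equiv := fun {_ r} => isEmptyElim r }
  let Q : T.Alg :=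
    { carrier := Quotient r
      sat := fun e he x => by
        obtain ⟨y, rfl⟩ : ∃ y : ℕ → A, x = fun i => (⟦y i⟧ : Quotient r) :=
          ⟨fun i => (x i).out, funext fun i => (Quotient.out_eq _).symm⟩
        rw [Term.realize_quotient_mk', Term.realize_quotient_mk']
        exact congrArg _ (A.sat e he y) }
  exact ⟨Q, mkHom (B := Q) (fun x => (⟦x⟧ : Quotient r))
    fun s x => (funMap_quotient_mk' r s x).symm, fun x y => Quotient.eq⟩

theorem exact {R X : T.Alg} (r₁ r₂ : R ⟶ X) (h : SemiAb.IsEquivalenceRelation r₁ r₂) :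
    ∃ (Q : T.Alg) (q : X ⟶ Q), IsKernelPair q r₁ r₂ := by
  have hj := jointly_injective (r := r₁) (s := r₂) h.jointly_mono
  obtain ⟨d, hd₁, hd₂⟩ := h.refl
  obtain ⟨t, ht₁, ht₂⟩ := h.symm
  let i := subι (eqSub (pr₁ R R ≫ r₂) (pr₂ R R ≫ r₁))
  obtain ⟨c, hc₁, hc₂⟩ := h.trans (i ≫ pr₁ R R) (i ≫ pr₂ R R)
    (eqSub_condition (pr₁ R R ≫ r₂) (pr₂ R R ≫ r₁))
  let r : Setoid X :=
    { r := fun x y => ∃ z, r₁.hom z = x ∧ r₂.hom z = y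
      iseqv :=
        { refl := fun x => ⟨d.hom x, congr_hom hd₁ x, congr_hom hd₂ x⟩
          symm := by
            rintro _ _ ⟨z, rfl, rfl⟩
            exact ⟨t.hom z, congr_hom ht₁ z, congr_hom ht₂ z⟩
          trans := by
            rintro _ _ _ ⟨z, rfl, hz⟩ ⟨z', hz', rfl⟩
            have hzz : r₂.hom z = r₁.hom z' := hz.trans hz'.symm
            exact ⟨c.hom ⟨(z, z'), hzz⟩, congr_hom hc₁ _, congr_hom hc₂ _⟩ } }
  obtain ⟨Q, q, hq⟩ := exists_quotient r (by
    intro n s x y hxy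
    choose z hz₁ hz₂ using hxy
    refine ⟨Structure.funMap s z, ?_, ?_⟩
    · rw [FirstOrder.Language.Hom.map_fun]
      exact congrArg _ (funext hz₁)
    · rw [FirstOrder.Language.Hom.map_fun]
      exact congrArg _ (funext hz₂))
  have w : r₁ ≫ q = r₂ ≫ q := hom_ext fun z => (hq _ _).2 ⟨z, rfl, rfl⟩
  have hl : ∀ {S : T.Alg} (a b : S ⟶ X), a ≫ q = b ≫ q →
      ∃ l : S ⟶ R, l ≫ r₁ = a ∧ l ≫ r₂ = b := by
    intro S a b hab
    have : ∀ x, ∃ z, r₁.hom z = a.hom x ∧ r₂.hom z = b.hom x :=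
      fun x => (hq _ _).1 (congr_hom hab x)
    choose l hl₁ hl₂ using this
    refine ⟨mkHom l ?_, hom_ext hl₁, hom_ext hl₂⟩
    intro n s x
    apply hj
    · rw [hl₁, FirstOrder.Language.Hom.map_fun, FirstOrder.Language.Hom.map_fun]
      exact congrArg _ (funext fun i => (hl₁ _).symm)
    · rw [hl₂, FirstOrder.Language.Hom.map_fun, FirstOrder.Language.Hom.map_fun]
      exact congrArg _ (funext fun i => (hl₂ _).symm)
  exact ⟨Q, q, ⟨w⟩, ⟨PullbackCone.IsLimit.mk _
    (fun s => (hl s.fst s.snd s.condition).choose)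
    (fun s => (hl s.fst s.snd s.condition).choose_spec.1)
    (fun s => (hl s.fst s.snd s.condition).choose_spec.2)
    fun s m h₁ h₂ => h.jointly_mono _ _
      (h₁.trans (hl s.fst s.snd s.condition).choose_spec.1.symm)
      (h₂.trans (hl s.fst s.snd s.condition).choose_spec.2.symm)⟩⟩

end quotients

theorem hom_op₀ {A B : T.Alg} (f : A ⟶ B) (c : T.lang.Functions 0) :
    f.hom (op₀ c) = op₀ c := by
  unfold op₀
  rw [FirstOrder.Language.Hom.map_fun]
  exact congrArg _ (Subsingleton.elim _ _)

theorem hom_op₁ {A B : T.Alg} (f : A ⟶ B) (s : T.lang.Functions 1) (x : A) :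
    f.hom (op₁ s x) = op₁ s (f.hom x) := by
  unfold op₁
  rw [FirstOrder.Language.Hom.map_fun]
  congr 1
  funext i
  fin_cases i
  rfl

theorem hom_op₂ {A B : T.Alg} (f : A ⟶ B) (s : T.lang.Functions 2) (x y : A) :
    f.hom (op₂ s x y) = op₂ s (f.hom x) (f.hom y) := by
  unfold op₂
  rw [FirstOrder.Language.Hom.map_fun]
  congr 1
  funext i
  fin_cases i <;> rfl

end Alg

end EquationalTheory

/-! ### Categories of interest are semi-abelian -/

namespace CategoryOfInterest

variable {𝒱 : CategoryOfInterest.{u}}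

instance (A : 𝒱.Algebras) : Add A.carrier := ⟨op₂ 𝒱.add⟩

instance (A : 𝒱.Algebras) : Zero A.carrier := ⟨op₀ 𝒱.zero⟩

instance (A : 𝒱.Algebras) : Neg A.carrier := ⟨op₁ 𝒱.neg⟩

/-- The underlying group. -/
instance addGroup (A : 𝒱.Algebras) : AddGroup A.carrier where
  add_assoc := 𝒱.add_assoc A
  zero_add := 𝒱.zero_add A
  add_zero := 𝒱.add_zero A
  neg_add_cancel := 𝒱.neg_add A
  nsmul := nsmulRec
  zsmul := zsmulRec

theorem hom_zero {A B : 𝒱.Algebras} (f : A ⟶ B) : f.hom 0 = 0 := hom_op₀ f _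

theorem hom_add {A B : 𝒱.Algebras} (f : A ⟶ B) (x y : A) :
    f.hom (x + y) = f.hom x + f.hom y := hom_op₂ f _ _ _

theorem hom_neg {A B : 𝒱.Algebras} (f : A ⟶ B) (x : A) : f.hom (-x) = -f.hom x := hom_op₁ f _ _

theorem op₁_zero {A : 𝒱.Algebras} (ω : 𝒱.lang.Functions 1) : op₁ ω (0 : A) = 0 := by
  by_cases h : ω = 𝒱.neg
  · rw [h]
    exact neg_zero (G := A.carrier)
  · have := 𝒱.map_add ω h A 0 0
    change op₁ ω ((0 : A) + 0) = op₁ ω (0 : A) + op₁ ω (0 : A) at this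
    simpa using this

theorem op₂_zero {A : 𝒱.Algebras} (m : 𝒱.lang.Functions 2) : op₂ m (0 : A) 0 = 0 := by
  by_cases h : m = 𝒱.add
  · rw [h]
    exact _root_.add_zero (0 : A)
  · have := 𝒱.mul_add m h A 0 0 0
    change op₂ m (0 : A) ((0 : A) + 0) = op₂ m (0 : A) 0 + op₂ m (0 : A) 0 at this
    simpa using this

/-- All operations send zeros to zero. -/
theorem funMap_zero {A : 𝒱.Algebras} {n : ℕ} (s : 𝒱.lang.Functions n) :
    Structure.funMap s (fun _ => (0 : A)) = 0 := by
  have hn := 𝒱.arity_le_two n s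
  interval_cases n
  · rw [𝒱.zero_unique s]
    exact congrArg _ (Subsingleton.elim _ _)
  · refine Eq.trans (congrArg _ ?_) (op₁_zero s)
    funext i
    fin_cases i
    rfl
  · refine Eq.trans (congrArg _ ?_) (op₂_zero s)
    funext i
    fin_cases i <;> rfl

instance : HasZeroMorphisms 𝒱.Algebras where
  zero _ _ := ⟨mkHom (fun _ => 0) fun s _ => (funMap_zero s).symm⟩
  comp_zero _ _ := rfl
  zero_comp _ _ _ f := hom_ext fun _ => hom_zero f

theorem zero_hom_apply {A B : 𝒱.Algebras} (x : A) : Hom.hom (0 : A ⟶ B) x = 0 := rfl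

variable (𝒱) in
/-- The one-point algebra. -/
def point : 𝒱.Algebras where
  carrier := PUnit
  str := { funMap := fun _ _ => PUnit.unit, RelMap := fun r => isEmptyElim r }
  sat _ _ _ := rfl

instance : HasZeroObject 𝒱.Algebras :=
  ⟨point 𝒱, fun _ => ⟨⟨⟨0⟩, fun f => hom_ext fun _ => hom_zero f⟩⟩,
    fun _ => ⟨⟨⟨0⟩, fun _ => hom_ext fun _ => rfl⟩⟩⟩

/-- Points of a kernel. -/
theorem exists_of_isLimit {K A B : 𝒱.Algebras} {k : K ⟶ A} {p : A ⟶ B} {w : k ≫ p = 0}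
    (h : IsLimit (KernelFork.ofι k w)) (x : A) (hx : p.hom x = 0) : ∃ z, k.hom z = x := by
  have hw : subι (eqSub p 0) ≫ p = 0 := (eqSub_condition p 0).trans comp_zero
  obtain ⟨l, hl⟩ := KernelFork.IsLimit.lift' h (subι (eqSub p 0)) hw
  exact ⟨l.hom ⟨x, hx⟩, congr_hom hl _⟩

instance : SemiAb.SemiAbelian 𝒱.Algebras where
  hasBinaryCoproducts := inferInstance
  exact := EquationalTheory.Alg.exact
  protomodular := by
    rintro K A B K' A' B' k p s k' p' s' hk hk' f g h ⟨ik⟩ ⟨ik'⟩ hs hs' e₁ e₂ e₃ hf hh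
    have bf := bijective_of_isIso f
    have bh := bijective_of_isIso h
    have mk' : Mono k' := Fork.IsLimit.mono ik'
    have jk' := injective_of_mono k'
    apply isIso_of_bijective
    have inj : ∀ d, g.hom d = 0 → d = 0 := by
      intro d hd
      have h1 : p.hom d = 0 := bh.1 (by
        have := congr_hom e₂ d
        simp only [comp_hom_apply] at this
        rw [this, hd, hom_zero, hom_zero])
      obtain ⟨z, rfl⟩ := exists_of_isLimit ik d h1
      have h2 : f.hom z = 0 := jk' (by
        have := congr_hom e₁ z
        simp only [comp_hom_apply] at this
        rw [← this, hd, hom_zero])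
      have h3 : z = 0 := bf.1 (by rw [h2, hom_zero])
      rw [h3, hom_zero]
    constructor
    · intro a b hab
      have := inj (a + -b) (by rw [hom_add, hom_neg, hab, add_neg_cancel])
      exact add_neg_eq_zero.1 this
    · intro a
      obtain ⟨b, hb⟩ := bh.2 (p'.hom a)
      have h1 : p'.hom (a + -g.hom (s.hom b)) = 0 := by
        have h2 := congr_hom e₂ (s.hom b)
        have h3 := congr_hom hs b
        simp only [comp_hom_apply, id_hom_apply] at h2 h3
        rw [hom_add, hom_neg, ← h2, h3, hb, add_neg_cancel]
      obtain ⟨y, hy⟩ := exists_of_isLimit ik' _ h1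
      obtain ⟨z, rfl⟩ := bf.2 y
      refine ⟨k.hom z + s.hom b, ?_⟩
      have h4 := congr_hom e₁ z
      simp only [comp_hom_apply] at h4
      rw [hom_add, h4, hy, neg_add_cancel_right]

end CategoryOfInterest

/-! ### Words in closed subsets, and points of images -/

namespace EquationalTheory.Alg

variable {T : EquationalTheory.{u}}

/-! Write the normal subobjects as kernels K and L, and let N be the additive subgroup of X
generated by all k + l - k - l and all products k * l. Two facts give the theorem: N is the kernel
of a morphism, and N is the set of points of [K, L].

N is a kernel because it is an ideal. Conjugation and the additive unary operations send generators
to generators. Multiplication by x is additive with central values, so it kills group commutators;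
what remains is, up to passing to an opposite operation, (k * l) • x. Here (CI8) is decisive: this
element is a word in elements of the forms k * (l • x) and l * (k • x), which lie in N because K and
L are both ideals, and N is closed under all operations (`mul_mul_mem`). The quotient X/N is formed
in `exists_quotient_kernelCommutator`.

For the second fact, each generator lifts to an element of the coproduct killed by both projections,
hence to the co-smash product (`commutatorSubgroup_le_range`). Conversely, in X/N the images of K
and L commute and annihilate each other, so (k, l) ↦ k + l is a morphism on K × L
(`exists_prod_hom`). Thus K + L → X → X/N factors through K × L and vanishes on the co-smash product
(`coSmashι_desc_comp_eq_zero`). -/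

theorem eval_mem {A : T.Alg} {S : Set A.carrier}
    (hS : ∀ {n} (s : T.lang.Functions n) (x : Fin n → A.carrier), (∀ i, x i ∈ S) →
      Structure.funMap s x ∈ S)
    {α : Type*} (w : T.lang.Term α) (x : α → A) (hx : ∀ i, x i ∈ S) : A.eval w x ∈ S := by
  induction w with
  | var i => exact hx i
  | func s ts ih => exact hS s _ ih

/-- The arrow of the image subobject has the same points as the range. -/
theorem mem_range_imageSubobject_arrow {A B : T.Alg} (f : A ⟶ B) (y : B) :
    (∃ z, (imageSubobject f).arrow.hom z = y) ↔ ∃ x, f.hom x = y := by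
  constructor
  · rintro ⟨z, rfl⟩
    have := mono_of_injective _ (subι_injective f.hom.range)
    -- The image is the least subobject through which `f` factors, so it lies inside the
    -- set-theoretic range.
    have hle : imageSubobject f ≤ Subobject.mk (subι f.hom.range) :=
      imageSubobject_le_mk (subι f.hom.range) f (toRange f) (toRange_comp f)
    have h := congr_hom (Subobject.ofLEMk_comp hle) z
    rw [← h]
    exact ((Subobject.ofLEMk _ _ hle).hom z).2
  · rintro ⟨x, rfl⟩
    exact ⟨(factorThruImageSubobject f).hom x, congr_hom (imageSubobject_arrow_comp f) x⟩

end EquationalTheory.Alg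

/-! ### Arithmetic of the operations -/

namespace CategoryOfInterest

variable {𝒱 : CategoryOfInterest.{u}}

/-- An induction principle for the operation symbols. -/
theorem functions_cases {P : ∀ n, 𝒱.lang.Functions n → Prop} (h_zero : P 0 𝒱.zero)
    (h_neg : P 1 𝒱.neg) (h_unary : ∀ ω, ω ≠ 𝒱.neg → P 1 ω) (h_add : P 2 𝒱.add)
    (h_binary : ∀ m, m ≠ 𝒱.add → P 2 m) {n : ℕ} (s : 𝒱.lang.Functions n) : P n s := by
  have hn := 𝒱.arity_le_two n s
  interval_cases n
  · rw [𝒱.zero_unique s]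
    exact h_zero
  · by_cases h : s = 𝒱.neg
    · rw [h]
      exact h_neg
    · exact h_unary s h
  · by_cases h : s = 𝒱.add
    · rw [h]
      exact h_add
    · exact h_binary s h

section operations

variable {A : 𝒱.Algebras}

theorem funMap_zero_symbol (x : Fin 0 → A.carrier) : Structure.funMap 𝒱.zero x = (0 : A) :=
  congrArg _ (Subsingleton.elim _ _)

theorem funMap_unary (ω : 𝒱.lang.Functions 1) (x : Fin 1 → A.carrier) :
    Structure.funMap ω x = op₁ ω (x 0) :=
  congrArg _ (funext fun i => by fin_cases i; rfl)

theorem funMap_neg (x : Fin 1 → A.carrier) : Structure.funMap 𝒱.neg x = -x 0 :=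
  funMap_unary _ x

theorem funMap_binary (m : 𝒱.lang.Functions 2) (x : Fin 2 → A.carrier) :
    Structure.funMap m x = op₂ m (x 0) (x 1) :=
  congrArg _ (funext fun i => by fin_cases i <;> rfl)

theorem funMap_add (x : Fin 2 → A.carrier) : Structure.funMap 𝒱.add x = x 0 + x 1 :=
  funMap_binary _ x

/-- A unary operation other than the negation, as a group homomorphism. -/
def op₁Hom (A : 𝒱.Algebras) {ω : 𝒱.lang.Functions 1} (h : ω ≠ 𝒱.neg) :
    A.carrier →+ A.carrier :=
  AddMonoidHom.mk' (op₁ ω) (𝒱.map_add ω h A)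

/-- Left multiplication by an element, as a group homomorphism. -/
def mulHom {m : 𝒱.lang.Functions 2} (h : m ≠ 𝒱.add) (x : A.carrier) : A.carrier →+ A.carrier :=
  AddMonoidHom.mk' (op₂ m x) (𝒱.mul_add m h A x)

variable {m : 𝒱.lang.Functions 2}

theorem mul_distrib (h : m ≠ 𝒱.add) (x y z : A) : op₂ m x (y + z) = op₂ m x y + op₂ m x z :=
  𝒱.mul_add m h A x y z

theorem mul_zero_right (h : m ≠ 𝒱.add) (x : A) : op₂ m x 0 = 0 := (mulHom h x).map_zero

/-- (CI5) concerns the right argument only; the opposite operation transfers it to the left one. -/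
theorem add_distrib (h : m ≠ 𝒱.add) (x y z : A) : op₂ m (x + y) z = op₂ m x z + op₂ m y z := by
  obtain ⟨m', h', e⟩ := 𝒱.exists_opposite m h
  rw [← e, ← e, ← e, mul_distrib h']

theorem mul_zero_left (h : m ≠ 𝒱.add) (x : A) : op₂ m 0 x = 0 := by
  obtain ⟨m', h', e⟩ := 𝒱.exists_opposite m h
  rw [← e, mul_zero_right h']

theorem add_mul_comm' (h : m ≠ 𝒱.add) (x y z : A) : x + op₂ m y z = op₂ m y z + x := 𝒱.add_mul_comm m h A x y z

end operations

/-! ### The subgroup generated by commutators and products -/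

/-- The additive subgroup generated by the commutators and the products of elements of
two subsets. -/
def commutatorSubgroup {X : 𝒱.Algebras} (K L : Set X.carrier) : AddSubgroup X.carrier :=
  AddSubgroup.closure {x | ∃ k ∈ K, ∃ l ∈ L,
    x = k + l + -k + -l ∨ ∃ m : 𝒱.lang.Functions 2, m ≠ 𝒱.add ∧ x = op₂ m k l}

section commutatorSubgroup

variable {X : 𝒱.Algebras} {K L : Set X.carrier}

theorem add_commutator_mem {k l : X.carrier} (hk : k ∈ K) (hl : l ∈ L) :
    k + l + -k + -l ∈ commutatorSubgroup K L :=
  AddSubgroup.subset_closure ⟨k, hk, l, hl, Or.inl rfl⟩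

theorem mul_mem {k l : X.carrier} (hk : k ∈ K) (hl : l ∈ L) {m : 𝒱.lang.Functions 2}
    (h : m ≠ 𝒱.add) : op₂ m k l ∈ commutatorSubgroup K L :=
  AddSubgroup.subset_closure ⟨k, hk, l, hl, Or.inr ⟨m, h, rfl⟩⟩

/-- The generators carry the element of `K` on the left; by (CI3) the other order gives nothing new.
-/
theorem mul_mem' {k l : X.carrier} (hk : k ∈ K) (hl : l ∈ L) {m : 𝒱.lang.Functions 2}
    (h : m ≠ 𝒱.add) : op₂ m l k ∈ commutatorSubgroup K L := by
  obtain ⟨m', h', e⟩ := 𝒱.exists_opposite m h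
  rw [← e]
  exact mul_mem hk hl h'

theorem commutatorSubgroup_le (N : AddSubgroup X.carrier)
    (h₁ : ∀ k ∈ K, ∀ l ∈ L, k + l + -k + -l ∈ N)
    (h₂ : ∀ k ∈ K, ∀ l ∈ L, ∀ m : 𝒱.lang.Functions 2, m ≠ 𝒱.add → op₂ m k l ∈ N) :
    commutatorSubgroup K L ≤ N := by
  refine (AddSubgroup.closure_le _).2 ?_
  rintro _ ⟨k, hk, l, hl, rfl | ⟨m, h, rfl⟩⟩
  exacts [h₁ k hk l hl, h₂ k hk l hl m h]

end commutatorSubgroup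

/-! ### The commutator of two kernels is an ideal -/

section ideals

/-- The elements sent to zero by a morphism, as an additive subgroup. -/
def zeroLocus {X Y : 𝒱.Algebras} (p : X ⟶ Y) : AddSubgroup X.carrier :=
  (AddMonoidHom.mk' p.hom (hom_add p)).ker

theorem mem_zeroLocus {X Y : 𝒱.Algebras} {p : X ⟶ Y} {x : X} :
    x ∈ zeroLocus p ↔ p.hom x = 0 := AddMonoidHom.mem_ker

variable {X Y Z : 𝒱.Algebras} {p : X ⟶ Y} {q : X ⟶ Z}

theorem zeroLocus_conj {k : X} (hk : k ∈ zeroLocus p) (x : X) : x + k + -x ∈ zeroLocus p := by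
  rw [mem_zeroLocus] at *
  simp [hom_add, hom_neg, hk]

theorem zeroLocus_op₁ {k : X} (hk : k ∈ zeroLocus p) (ω : 𝒱.lang.Functions 1) :
    op₁ ω k ∈ zeroLocus p := by
  rw [mem_zeroLocus] at *
  rw [hom_op₁, hk, op₁_zero]

theorem zeroLocus_mul_right {k : X} (hk : k ∈ zeroLocus p) {m : 𝒱.lang.Functions 2}
    (h : m ≠ 𝒱.add) (x : X) : op₂ m k x ∈ zeroLocus p := by
  rw [mem_zeroLocus] at *
  rw [hom_op₂, hk, mul_zero_left h]

theorem zeroLocus_mul_left {k : X} (hk : k ∈ zeroLocus p) {m : 𝒱.lang.Functions 2}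
    (h : m ≠ 𝒱.add) (x : X) : op₂ m x k ∈ zeroLocus p := by
  rw [mem_zeroLocus] at *
  rw [hom_op₂, hk, mul_zero_right h]

variable (p q) in
/-- The commutator subgroup of two kernels. -/
abbrev kernelCommutator : AddSubgroup X.carrier :=
  commutatorSubgroup (zeroLocus p : Set X.carrier) (zeroLocus q : Set X.carrier)

theorem kernelCommutator_le_left : kernelCommutator p q ≤ zeroLocus p := by
  refine commutatorSubgroup_le _ (fun k hk l _ => ?_) fun k hk l _ m h =>
    zeroLocus_mul_right hk h l
  -- Bracket the commutator as k + (l - k - l): an element of the kernel plus a conjugate of its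
  -- negative.
  have := add_mem hk (zeroLocus_conj (neg_mem hk) l)
  simpa [_root_.add_assoc] using this

theorem kernelCommutator_le_right : kernelCommutator p q ≤ zeroLocus q :=
  commutatorSubgroup_le _ (fun k _ _ hl => add_mem (zeroLocus_conj hl k) (neg_mem hl))
    fun k _ _ hl _ h => zeroLocus_mul_left hl h k

/-- Conjugation by x turns the commutator of k and l into that of their conjugates, which stay in
the two kernels, and it fixes products because they are central. -/
instance kernelCommutator_normal : (kernelCommutator p q).Normal where
  conj_mem n hn x := by
    have : kernelCommutator p q ≤
        (kernelCommutator p q).comap (AddMonoidHom.mk' (fun y => x + y + -x)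
          fun a b => by simp [_root_.add_assoc]) := by
      refine commutatorSubgroup_le _ (fun k hk l hl => ?_) fun k hk l hl m h => ?_
      · have := add_commutator_mem (zeroLocus_conj hk x) (zeroLocus_conj hl x)
        simpa [AddSubgroup.mem_comap, _root_.add_assoc] using this
      · have := mul_mem hk hl h
        simpa [AddSubgroup.mem_comap, add_mul_comm' h] using this
    simpa using this hn

/-- By additivity ω sends commutators to commutators, and by (CI6) it sends k * l to ω(k) * l. -/
theorem kernelCommutator_op₁ {n : X} (hn : n ∈ kernelCommutator p q) {ω : 𝒱.lang.Functions 1}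
    (h : ω ≠ 𝒱.neg) : op₁ ω n ∈ kernelCommutator p q := by
  have : kernelCommutator p q ≤ (kernelCommutator p q).comap (op₁Hom X h) := by
    refine commutatorSubgroup_le _ (fun k hk l hl => ?_) fun k hk l hl m hm => ?_
    · simp only [AddSubgroup.mem_comap, _root_.map_add, map_neg]
      exact add_commutator_mem (zeroLocus_op₁ hk ω) (zeroLocus_op₁ hl ω)
    · change op₁ ω (op₂ m k l) ∈ kernelCommutator p q
      rw [← 𝒱.map_mul ω h m hm]
      exact mul_mem (zeroLocus_op₁ hk ω) hl hm
  exact this hn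

/-- Closure under every operation is needed because (CI8) allows an arbitrary word. A product of two
members is itself a generator, since the subgroup lies in both kernels. -/
theorem kernelCommutator_funMap {n : ℕ} (s : 𝒱.lang.Functions n) : ∀ x : Fin n → X.carrier,
    (∀ i, x i ∈ kernelCommutator p q) → Structure.funMap s x ∈ kernelCommutator p q := by
  induction s using functions_cases with
  | h_zero =>
    intro x _
    rw [funMap_zero_symbol]
    exact zero_mem _
  | h_neg =>
    intro x hx
    rw [funMap_neg]
    exact neg_mem (hx 0)
  | h_unary ω h =>
    intro x hx
    rw [funMap_unary]
    exact kernelCommutator_op₁ (hx 0) h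
  | h_add =>
    intro x hx
    rw [funMap_add]
    exact add_mem (hx 0) (hx 1)
  | h_binary m h =>
    intro x hx
    rw [funMap_binary]
    exact mul_mem (kernelCommutator_le_left (hx 0)) (kernelCommutator_le_right (hx 1)) h

/-- This is where (CI8) and the ideal property of both kernels meet: the outside factor x is
absorbed into l or into k, leaving a word in products of an element of one kernel with an element of
the other. -/
theorem mul_mul_mem {k l : X} (hk : k ∈ zeroLocus p) (hl : l ∈ zeroLocus q)
    {m d : 𝒱.lang.Functions 2} (hm : m ≠ 𝒱.add) (hd : d ≠ 𝒱.add) (x : X) :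
    op₂ d (op₂ m k l) x ∈ kernelCommutator p q := by
  obtain ⟨a, b, w, ms, ds, hms, hds, e⟩ := 𝒱.mul_mul m hm d hd
  rw [e]
  refine eval_mem (S := (kernelCommutator p q : Set X.carrier)) kernelCommutator_funMap w _ ?_
  rintro (i | j)
  · exact mul_mem hk (zeroLocus_mul_right hl (hds _) x) (hms _)
  · exact mul_mem' (zeroLocus_mul_right hk (hds _) x) hl (hms _)

theorem kernelCommutator_mul_left {n : X} (hn : n ∈ kernelCommutator p q)
    {m : 𝒱.lang.Functions 2} (h : m ≠ 𝒱.add) (x : X) : op₂ m x n ∈ kernelCommutator p q := by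
  have : kernelCommutator p q ≤ (kernelCommutator p q).comap (mulHom h x) := by
    refine commutatorSubgroup_le _ (fun k hk l hl => ?_) fun k hk l hl d hd => ?_
    · simp only [AddSubgroup.mem_comap, _root_.map_add, map_neg]
      -- The values of multiplication by x are products, hence central, so the image of a group
      -- commutator is trivial.
      have e : mulHom h x k + mulHom h x l = mulHom h x l + mulHom h x k :=
        add_mul_comm' h _ x l
      rw [e, add_neg_cancel_right, add_neg_cancel]
      exact zero_mem _
    · obtain ⟨m', h', e⟩ := 𝒱.exists_opposite m h
      change op₂ m x (op₂ d k l) ∈ kernelCommutator p q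
      rw [← e]
      exact mul_mul_mem hk hl hd h' x
  exact this hn

-- An additive normal subgroup stable under the unary operations and under multiplication by X
-- defines a congruence compatible with all operations, and the class of 0 is the subgroup.
variable (p q) in
theorem exists_quotient_kernelCommutator :
    ∃ (Q : 𝒱.Algebras) (r : X ⟶ Q), zeroLocus r = kernelCommutator p q := by
  -- Normality of the subgroup makes its coset relation an additive congruence.
  let c := QuotientAddGroup.con (kernelCommutator p q)
  have hc : ∀ x y, c x y ↔ -x + y ∈ kernelCommutator p q :=
    fun x y => QuotientAddGroup.leftRel_apply
  obtain ⟨Q, r, hr⟩ := exists_quotient (T := 𝒱.toEquationalTheory) c.toSetoid (by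
    intro n s
    induction s using functions_cases with
    | h_zero =>
      intro x y _
      rw [funMap_zero_symbol, funMap_zero_symbol]
    | h_neg =>
      intro x y hxy
      rw [funMap_neg, funMap_neg]
      exact c.neg (hxy 0)
    | h_unary ω h =>
      intro x y hxy
      rw [funMap_unary, funMap_unary]
      refine (hc _ _).2 ?_
      have := kernelCommutator_op₁ ((hc _ _).1 (hxy 0)) h
      change op₁Hom X h _ ∈ _ at this
      rwa [_root_.map_add, map_neg] at this
    | h_add =>
      intro x y hxy
      rw [funMap_add, funMap_add]
      exact c.add (hxy 0) (hxy 1)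
    | h_binary m h =>
      intro x y hxy
      rw [funMap_binary, funMap_binary]
      -- Change one factor at a time: the right one by left multiplication, then the left one
      -- through the opposite operation.
      refine c.trans (y := op₂ m (x 0) (y 1)) ((hc _ _).2 ?_) ((hc _ _).2 ?_)
      · have := kernelCommutator_mul_left ((hc _ _).1 (hxy 1)) h (x 0)
        change mulHom h (x 0) _ ∈ _ at this
        rwa [_root_.map_add, map_neg] at this
      · obtain ⟨m', h', e⟩ := 𝒱.exists_opposite m h
        have := kernelCommutator_mul_left ((hc _ _).1 (hxy 0)) h' (y 1)
        change mulHom h' (y 1) _ ∈ _ at this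
        rw [_root_.map_add, map_neg] at this
        rw [← e, ← e]
        exact this)
  refine ⟨Q, r, AddSubgroup.ext fun x => ?_⟩
  have := hr 0 x
  rw [hom_zero] at this
  rw [mem_zeroLocus, eq_comm, this]
  exact (hc _ _).trans (by rw [neg_zero, _root_.zero_add])

end ideals

/-! ### Morphisms out of a product, and kernels recognised on points -/

/-- Morphisms whose images commute and annihilate each other cooperate. -/
theorem exists_prod_hom {K L Q : 𝒱.Algebras} (f : K ⟶ Q) (g : L ⟶ Q)
    (hc : ∀ k l, f.hom k + g.hom l = g.hom l + f.hom k)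
    (hz : ∀ k l (m : 𝒱.lang.Functions 2), m ≠ 𝒱.add → op₂ m (f.hom k) (g.hom l) = 0) :
    ∃ φ : K ⨯ L ⟶ Q, ∀ z, φ.hom z =
      f.hom ((prod.fst : K ⨯ L ⟶ K).hom z) + g.hom ((prod.snd : K ⨯ L ⟶ L).hom z) := by
  have hz' : ∀ k l (m : 𝒱.lang.Functions 2), m ≠ 𝒱.add →
      op₂ m (g.hom l) (f.hom k) = 0 := by
    intro k l m h
    obtain ⟨m', h', e⟩ := 𝒱.exists_opposite m h
    rw [← e, hz k l m' h']
  refine ⟨mkHom (fun z => f.hom ((prod.fst : K ⨯ L ⟶ K).hom z) +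
    g.hom ((prod.snd : K ⨯ L ⟶ L).hom z)) ?_, fun _ => rfl⟩
  intro n s
  induction s using functions_cases with
  | h_zero =>
    intro x
    rw [funMap_zero_symbol, funMap_zero_symbol]
    simp only [hom_zero, _root_.add_zero]
  | h_neg =>
    intro x
    rw [funMap_neg, funMap_neg]
    simp only [hom_neg, Function.comp_apply, neg_add_rev]
    -- Negation reverses the order of the sum; commutation of the two images restores it.
    rw [← hom_neg g, ← hom_neg f, hc]
  | h_unary ω h =>
    intro x
    rw [funMap_unary, funMap_unary]
    simp only [hom_op₁, Function.comp_apply]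
    exact (𝒱.map_add ω h Q _ _).symm
  | h_add =>
    intro x
    rw [funMap_add, funMap_add]
    simp only [hom_add, Function.comp_apply]
    rw [_root_.add_assoc, _root_.add_assoc, ← _root_.add_assoc (f.hom _) (g.hom _) (g.hom _), hc,
      _root_.add_assoc]
  | h_binary m h =>
    intro x
    rw [funMap_binary, funMap_binary]
    simp only [hom_op₂, Function.comp_apply]
    -- Of the four terms of the expanded product, the two mixed ones vanish.
    rw [add_distrib h, mul_distrib h, mul_distrib h, hz _ _ m h, hz' _ _ m h,
      _root_.add_zero, _root_.zero_add]

/-- A mono whose points are the elements sent to zero by `r` is normal. -/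
theorem nonempty_normalMono {I X Q : 𝒱.Algebras} (i : I ⟶ X) [Mono i] (r : X ⟶ Q)
    (h : ∀ x, (∃ z, i.hom z = x) ↔ r.hom x = 0) : Nonempty (NormalMono i) := by
  have w : i ≫ r = 0 := hom_ext fun z => (h _).1 ⟨z, rfl⟩
  have hj := injective_of_mono i
  have hl : ∀ {S : 𝒱.Algebras} (a : S ⟶ X), a ≫ r = 0 → ∃ l : S ⟶ I, l ≫ i = a := by
    intro S a ha
    choose l hl using fun x => (h (a.hom x)).2 (congr_hom ha x)
    refine ⟨mkHom l fun s x => hj ?_, hom_ext hl⟩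
    rw [hl, FirstOrder.Language.Hom.map_fun, FirstOrder.Language.Hom.map_fun]
    exact congrArg _ (funext fun j => (hl _).symm)
  exact ⟨⟨Q, r, w, KernelFork.IsLimit.ofι' i w fun a ha =>
    ⟨(hl a ha).choose, (hl a ha).choose_spec⟩⟩⟩

/-! ### The Higgins commutator in terms of elements -/

section higgins

variable {K L : 𝒱.Algebras}

/-- The co-smash product is the kernel of the map to K × L, and vanishing there can be tested on the
two components, which are the two retractions of the coproduct. -/
theorem exists_coSmashι {t : (K ⨿ L : 𝒱.Algebras)}
    (h₁ : (coprod.desc (𝟙 K) (0 : L ⟶ K)).hom t = 0)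
    (h₂ : (coprod.desc (0 : K ⟶ L) (𝟙 L)).hom t = 0) :
    ∃ z, (SemiAb.coSmashι K L).hom z = t := by
  refine exists_of_isLimit (w := kernel.condition _)
    (kernelIsKernel (SemiAb.coprodToProd K L)) t ?_
  have e₁ : SemiAb.coprodToProd K L ≫ prod.fst = coprod.desc (𝟙 K) (0 : L ⟶ K) := by
    unfold SemiAb.coprodToProd
    rw [coprod.desc_comp, prod.lift_fst, prod.lift_fst]
  have e₂ : SemiAb.coprodToProd K L ≫ prod.snd = coprod.desc (0 : K ⟶ L) (𝟙 L) := by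
    unfold SemiAb.coprodToProd
    rw [coprod.desc_comp, prod.lift_snd, prod.lift_snd]
  refine jointly_injective (r := (prod.fst : K ⨯ L ⟶ K)) (s := (prod.snd : K ⨯ L ⟶ L))
    (fun _ _ h h' => Limits.prod.hom_ext h h') _ _ ?_ ?_
  · rw [← comp_hom_apply, e₁, h₁, hom_zero]
  · rw [← comp_hom_apply, e₂, h₂, hom_zero]

variable {X : 𝒱.Algebras} (k : K ⟶ X) (l : L ⟶ X)

theorem inl_desc_hom {B : 𝒱.Algebras} (f : K ⟶ B) (g : L ⟶ B) (a : K) :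
    (coprod.desc f g).hom ((coprod.inl : K ⟶ K ⨿ L).hom a) = f.hom a :=
  congr_hom (coprod.inl_desc f g) a

theorem inr_desc_hom {B : 𝒱.Algebras} (f : K ⟶ B) (g : L ⟶ B) (b : L) :
    (coprod.desc f g).hom ((coprod.inr : L ⟶ K ⨿ L).hom b) = g.hom b :=
  congr_hom (coprod.inr_desc f g) b

/-- Form each generator inside the coproduct, with its two entries in different summands. Sending
either summand to zero kills it, so it comes from the co-smash product, and it maps to the given
generator of X. -/
theorem commutatorSubgroup_le_range :
    commutatorSubgroup (Set.range k.hom) (Set.range l.hom) ≤ (AddMonoidHom.mk'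
      (SemiAb.coSmashι K L ≫ coprod.desc k l).hom (hom_add _)).range := by
  apply commutatorSubgroup_le
  · rintro _ ⟨a, rfl⟩ _ ⟨b, rfl⟩
    obtain ⟨z, hz⟩ := exists_coSmashι (K := K) (L := L)
      (t := (coprod.inl : K ⟶ K ⨿ L).hom a + (coprod.inr : L ⟶ K ⨿ L).hom b +
        -(coprod.inl : K ⟶ K ⨿ L).hom a + -(coprod.inr : L ⟶ K ⨿ L).hom b)
      (by simp [hom_add, hom_neg, inl_desc_hom, inr_desc_hom, zero_hom_apply])
      (by simp [hom_add, hom_neg, inl_desc_hom, inr_desc_hom, zero_hom_apply])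
    refine ⟨z, ?_⟩
    simp [hz, hom_add, hom_neg, inl_desc_hom, inr_desc_hom]
  · rintro _ ⟨a, rfl⟩ _ ⟨b, rfl⟩ m h
    obtain ⟨z, hz⟩ := exists_coSmashι (K := K) (L := L)
      (t := op₂ m ((coprod.inl : K ⟶ K ⨿ L).hom a) ((coprod.inr : L ⟶ K ⨿ L).hom b))
      (by simp [hom_op₂, inl_desc_hom, inr_desc_hom, zero_hom_apply, mul_zero_right h])
      (by simp [hom_op₂, inl_desc_hom, inr_desc_hom, zero_hom_apply, mul_zero_left h])
    refine ⟨z, ?_⟩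
    simp [hz, hom_op₂, inl_desc_hom, inr_desc_hom]

/-- Once `r` kills the generators, the images of K and L in Q cooperate, so the map from the
coproduct to Q factors through the product, whose comparison map kills the co-smash product. -/
theorem coSmashι_desc_comp_eq_zero {Q : 𝒱.Algebras} (r : X ⟶ Q)
    (h : commutatorSubgroup (Set.range k.hom) (Set.range l.hom) ≤ zeroLocus r) :
    (SemiAb.coSmashι K L ≫ coprod.desc k l) ≫ r = 0 := by
  obtain ⟨φ, hφ⟩ := exists_prod_hom (k ≫ r) (l ≫ r)
    (fun a b => by
      have := mem_zeroLocus.1 (h (add_commutator_mem (Set.mem_range_self a)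
        (Set.mem_range_self b)))
      simp only [hom_add, hom_neg] at this
      simp only [comp_hom_apply]
      rwa [add_neg_eq_zero, add_neg_eq_iff_eq_add] at this)
    (fun a b m hm => by
      have := mem_zeroLocus.1 (h (mul_mem (Set.mem_range_self a) (Set.mem_range_self b) hm))
      rwa [hom_op₂] at this)
  -- Checked on each summand: the comparison map sends a to (a, 0) or (0, a), on which φ is the
  -- composite of `k` or `l` with `r`.
  have e : coprod.desc k l ≫ r = SemiAb.coprodToProd K L ≫ φ := by
    unfold SemiAb.coprodToProd
    ext1
    · rw [coprod.inl_desc_assoc, coprod.inl_desc_assoc]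
      refine hom_ext fun a => ?_
      rw [comp_hom_apply (prod.lift _ _), hφ, ← comp_hom_apply _ prod.fst, ← comp_hom_apply _ prod.snd,
        prod.lift_fst, prod.lift_snd, zero_hom_apply, hom_zero, _root_.add_zero, id_hom_apply]
    · rw [coprod.inr_desc_assoc, coprod.inr_desc_assoc]
      refine hom_ext fun a => ?_
      rw [comp_hom_apply (prod.lift _ _), hφ, ← comp_hom_apply _ prod.fst, ← comp_hom_apply _ prod.snd,
        prod.lift_fst, prod.lift_snd, zero_hom_apply, hom_zero, _root_.zero_add, id_hom_apply]
  have w : SemiAb.coSmashι K L ≫ SemiAb.coprodToProd K L = 0 := kernel.condition _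
  rw [Category.assoc, e, ← Category.assoc, w, zero_comp]

end higgins

/-- Translates between the arrows used by the Higgins commutator and the zero loci used by the ideal
argument. -/
theorem range_normalMono {K X : 𝒱.Algebras} {k : K ⟶ X} (hk : NormalMono k) :
    Set.range k.hom = zeroLocus hk.g := by
  ext x
  refine ⟨?_, fun hx => exists_of_isLimit hk.isLimit x (mem_zeroLocus.1 hx)⟩
  rintro ⟨a, rfl⟩
  exact mem_zeroLocus.2 (congr_hom hk.w a)

end CategoryOfInterest

/-! ### Normality of the Higgins commutator -/

open CategoryOfInterest in
theorem mainTheorem3 (𝒱 : CategoryOfInterest.{u}) : SemiAb.NH 𝒱.Algebras := by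
  rintro X K L ⟨hK⟩ ⟨hL⟩
  obtain ⟨Q, r, hr⟩ := exists_quotient_kernelCommutator hK.g hL.g
  rw [kernelCommutator, ← range_normalMono hK, ← range_normalMono hL] at hr
  -- It remains to match the points of the image with the zeros of `r`, which form the commutator
  -- subgroup.
  refine nonempty_normalMono _ r fun x => ?_
  refine (mem_range_imageSubobject_arrow _ x).trans ⟨?_, fun hx => ?_⟩
  · rintro ⟨z, rfl⟩
    exact congr_hom (coSmashι_desc_comp_eq_zero K.arrow L.arrow r hr.ge) z
  · exact commutatorSubgroup_le_range K.arrow L.arrow (hr.le (mem_zeroLocus.2 hx))
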